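/- \textbf{Setting.} A Markov decision process (MDP) $\mathcal M$ consists of a countable set $S$ of states, partitioned into controlled and random states, a transition relation ${\longrightarrow}\subseteq S\times S$ in which every state has a successor, for each random state $s$ a probability distribution $P(s)$ over its successors, and a reward function $r:S\times S\to\mathbb R$. A run is an infinite path $s_0s_1s_2\cdots$. A strategy $\sigma$ assigns to each finite path that ends in a controlled state a probability distribution over the successors of that state; together with an initial state $s_0$ it induces a probability measure $\mathcal P_{\mathcal M,s_0,\sigma}$ on the runs from $s_0$. Let $$\mathrm{MP}_{\liminf\ge 0}=\Big\{s_0s_1\cdots \;:\; \liminf_{n\to\infty}\tfrac1n\sum_{j=0}^{n-1} r(s_j,s_{j+1})\ge 0\Big\}.$$ A strategy is implemented by a set $\mathsf M$ of memory modes if there are an initial mode $\mathsf m_0\in\mathsf M$ and a map $\tau$ that assigns to each pair $(\mathsf m,s)\in\mathsf M\times S$ a probability distribution on $\mathsf M\times S$, where $\tau(\mathsf m,s)$ is supported on $\mathsf M\times\{s': s\longrightarrow s'\}$ for controlled $s$ and has $P(s)$ as its marginal on $S$ for random $s$, such that after each finite path from $s_0$ that ends in a controlled state $s$ the strategy plays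 the next-state marginal of $\tau(\mathsf m,s)$, averaged over the conditional distribution of the current mode $\mathsf m$ given that path in the Markov chain on $\mathsf M\times S$ with transition function $\tau$ started in $(\mathsf m_0,s_0)$ (whenever that path has positive probability in this chain). A finite-memory randomized (FR) strategy is one implemented by a finite set $\mathsf M$. A $k$-bit Markov strategy is one implemented by $\mathsf M=\mathbb N\times\{0,1\}^k$, where the first component is a step counter that starts at $0$ and increases by $1$ in every step. \textbf{Theorem.} There exist a countable MDP $\mathcal M$ and a state $s_0$ such that $\mathcal M$ is finitely branching (every state has finitely many successors), $\mathcal M$ is acyclic (its transition graph has no directed cycle), the step counter is implicit in the state (for every state $s$ there is $n_s\in\mathbb N$ such that every path from $s_0$ to $s$ has length $n_s$), and: 1. $s_0$ is almost surely winning: there is a strategy $\hat\sigma$ with $\mathcal P_{\mathcal M,s_0,\hat\sigma}(\mathrm{MP}_{\liminf\ge 0})=1$; 2. every FR strategy $\sigma$ satisfies $\mathcal P_{\mathcal M,s_0,\sigma}(\mathrm{MP}_{\liminf\ge 0})=0$. In particular, almost surely winning strategies, even when they exist, cannot in general be chosen $k$-bit Markov for any $k\in\mathbb N$: for every $k\in\mathbb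 N$, every $k$-bit Markov strategy $\sigma$ in this $\mathcal M$ satisfies $\mathcal P_{\mathcal M,s_0,\sigma}(\mathrm{MP}_{\liminf\ge 0})\neq 1$. -/

import Mathlib

open MeasureTheory ProbabilityTheory Filter

/-- A Markov decision process with state set `S`; countability of `S` is assumed separately.
The distribution `prob s` is only used at random states, that is for `s ∉ controlled`. -/
structure MDP (S : Type) where
  controlled : Set S
  trans : S → S → Prop
  exists_succ : ∀ s, ∃ s', trans s s'
  prob : S → PMF S
  prob_succ : ∀ s, s ∉ controlled → ∀ s', prob s s' ≠ 0 → trans s s'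
  reward : S → S → ℝ

namespace MDP

variable {S : Type}

/-- No directed cycle in the graph of transitions. -/
def Acyclic (M : MDP S) : Prop :=
  ∀ s, ¬ Relation.TransGen M.trans s s

/-- Every state has finitely many successors. -/
def FinitelyBranching (M : MDP S) : Prop :=
  ∀ s, {s' | M.trans s s'}.Finite

/-- `path 0, …, path l` is a path of length `l` from `s` to `t`. -/
def IsPath (M : MDP S) (s t : S) (l : ℕ) (path : ℕ → S) : Prop :=
  path 0 = s ∧ path l = t ∧ ∀ i < l, M.trans (path i) (path (i + 1))

/-- For every state `s` there is a number `n` such that every path from `s₀` to `s` has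
length `n`. -/
def StepCounterImplicit (M : MDP S) (s₀ : S) : Prop :=
  ∀ s, ∃ n : ℕ, ∀ (l : ℕ) (path : ℕ → S), M.IsPath s₀ s l path → l = n

/-- A (history dependent, randomized) strategy. `act n h` is the distribution over the next state
after the states `h 0, …, h n`. Only the values on partial runs that end in a controlled
state are ever used. -/
structure Strategy (M : MDP S) where
  act : (n : ℕ) → ((i : Finset.Iic n) → S) → PMF S
  act_succ : ∀ n (h : (i : Finset.Iic n) → S),
    h ⟨n, Finset.mem_Iic.2 le_rfl⟩ ∈ M.controlled →
      ∀ s', act n h s' ≠ 0 → M.trans (h ⟨n, Finset.mem_Iic.2 le_rfl⟩) s'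

open Classical in
/-- The extension of a strategy to partial runs that end in a random state. -/
noncomputable def Strategy.next {M : MDP S} (σ : M.Strategy) (n : ℕ)
    (h : (i : Finset.Iic n) → S) : PMF S :=
  if h ⟨n, Finset.mem_Iic.2 le_rfl⟩ ∈ M.controlled then σ.act n h
  else M.prob (h ⟨n, Finset.mem_Iic.2 le_rfl⟩)

/-- `Strategy.next` as a Markov kernel from histories to states. -/
noncomputable def Strategy.kernel [Countable S] [MeasurableSpace S] [DiscreteMeasurableSpace S]
    {M : MDP S} (σ : M.Strategy) (n : ℕ) : Kernel ((i : Finset.Iic n) → S) S :=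
  Kernel.ofFunOfCountable (fun h => (σ.next n h).toMeasure)

instance [Countable S] [MeasurableSpace S] [DiscreteMeasurableSpace S]
    {M : MDP S} (σ : M.Strategy) (n : ℕ) : IsMarkovKernel (σ.kernel n) :=
  ⟨fun h => PMF.toMeasure.isProbabilityMeasure (σ.next n h)⟩

/-- The probability measure on sequences of states that is induced by the strategy `σ` from
the initial state `s₀` (Ionescu-Tulcea). It is carried by the runs from `s₀`, and its values on
cylinders are given by `MDP.runMeasure_cylinder`. -/
noncomputable def runMeasure [Countable S] [MeasurableSpace S] [DiscreteMeasurableSpace S]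
    (M : MDP S) (s₀ : S) (σ : M.Strategy) : Measure (ℕ → S) :=
  Kernel.traj (X := fun _ => S) (fun n => σ.kernel n) 0 (fun _ => s₀)

/-- The probability of a cylinder is the product of the probabilities of its steps. -/
theorem runMeasure_cylinder [Countable S] [MeasurableSpace S] [DiscreteMeasurableSpace S]
    (M : MDP S) (s₀ : S) (σ : M.Strategy) (ρ : ℕ → S) (h0 : ρ 0 = s₀) (n : ℕ) :
    M.runMeasure s₀ σ {x | ∀ i ≤ n, x i = ρ i} =
      ∏ i ∈ Finset.range n, σ.next i (fun j => ρ j) (ρ (i + 1)) := by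
  have hset : ∀ n, {x : ℕ → S | ∀ i ≤ n, x i = ρ i} =
      Preorder.frestrictLe (π := fun _ => S) n ⁻¹' {fun j : Finset.Iic n => ρ j} := by
    intro n
    ext x
    simp only [Set.mem_ofPred_eq, Set.mem_preimage, Set.mem_singleton_iff, funext_iff,
      Preorder.frestrictLe_apply, Subtype.forall, Finset.mem_Iic]
  induction n with
  | zero =>
    rw [hset, Finset.prod_range_zero, runMeasure, ← Measure.map_apply
      (Preorder.measurable_frestrictLe 0) (measurableSet_singleton _),
      Kernel.traj_map_frestrictLe_apply, Kernel.partialTraj_self]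
    have : (fun _ : Finset.Iic 0 => s₀) = fun j : Finset.Iic 0 => ρ j := by
      funext j
      have := Finset.mem_Iic.1 j.2
      rw [Nat.le_zero.1 this, h0]
    rw [Kernel.id_apply, this, Measure.dirac_apply_of_mem (Set.mem_singleton _)]
  | succ n ih =>
    have h1 : {x : ℕ → S | ∀ i ≤ n + 1, x i = ρ i} =
        (fun x : ℕ → S => (Preorder.frestrictLe (π := fun _ => S) n x, x (n + 1))) ⁻¹'
          (({fun j : Finset.Iic n => ρ j} : Set _) ×ˢ {ρ (n + 1)}) := by
      ext x
      have := Set.ext_iff.1 (hset n) x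
      simp only [Set.mem_ofPred_eq, Set.mem_preimage, Set.mem_prod] at this ⊢
      rw [← this, Set.mem_singleton_iff]
      constructor
      · exact fun h => ⟨fun i hi => h i (by omega), h _ le_rfl⟩
      · rintro ⟨h, h'⟩ i hi
        rcases Nat.le_succ_iff.1 hi with hi | rfl
        · exact h i hi
        · exact h'
    rw [h1, Finset.prod_range_succ, ← ih, hset, runMeasure,
      ← Measure.map_apply (by fun_prop) (.prod (measurableSet_singleton _)
        (measurableSet_singleton _)),
      ← Kernel.partialTraj_compProd_eq_map_traj (Nat.zero_le n),
      Measure.compProd_apply_prod (measurableSet_singleton _) (measurableSet_singleton _),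
      lintegral_singleton, ← Measure.map_apply (Preorder.measurable_frestrictLe n)
      (measurableSet_singleton _), Kernel.traj_map_frestrictLe_apply, mul_comm]
    congr 1
    exact PMF.toMeasure_apply_singleton _ _ (measurableSet_singleton _)

/-- The sequences of states whose mean payoff has a nonnegative limit inferior. The limit inferior
is taken in the extended reals, since the mean payoffs may be unbounded. -/
def meanPayoffLiminfNonneg (M : MDP S) : Set (ℕ → S) :=
  {ρ | (0 : EReal) ≤ liminf (fun n : ℕ =>
    (((1 / (n : ℝ)) * ∑ j ∈ Finset.range n, M.reward (ρ j) (ρ (j + 1)) : ℝ) : EReal)) atTop}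

/-- A memory-based rule `τ : Mem × S → 𝒟(Mem × S)` that updates the memory mode and the state
jointly. At random states the memory cannot influence the next state. -/
structure MemoryRule (M : MDP S) (Mem : Type) where
  step : Mem → S → PMF (Mem × S)
  step_controlled : ∀ m s, s ∈ M.controlled → ∀ m' s', step m s (m', s') ≠ 0 → M.trans s s'
  step_random : ∀ m s, s ∉ M.controlled → ∀ s', ∑' m', step m s (m', s') = M.prob s s'

open Classical in
/-- In the Markov chain on `Mem × S` given by `τ` and started with mode `m₀` in the state `ρ 0`,
the probability that the first `n + 1` states are `ρ 0, …, ρ n` and the mode after `n`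
steps is `m`. -/
noncomputable def MemoryRule.weight {M : MDP S} {Mem : Type} (τ : M.MemoryRule Mem) (m₀ : Mem)
    (ρ : ℕ → S) : ℕ → Mem → ENNReal
  | 0, m => if m = m₀ then 1 else 0
  | n + 1, m => ∑' m', τ.weight m₀ ρ n m' * τ.step m' (ρ n) (m, ρ (n + 1))

/-- `σ` is the strategy induced by `τ` and `m₀` from `s₀`: after the states `ρ 0, …, ρ n`
it plays according to `τ`, averaged over the conditional distribution
`weight n m / ∑ m, weight n m` of the current mode `m`. The condition is imposed on
those partial runs from `s₀` where this conditional distribution is defined. -/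
def MemoryRule.Induces {M : MDP S} {Mem : Type} (τ : M.MemoryRule Mem) (m₀ : Mem)
    (s₀ : S) (σ : M.Strategy) : Prop :=
  ∀ (ρ : ℕ → S) (n : ℕ), ρ 0 = s₀ → ρ n ∈ M.controlled →
    ∑' m, τ.weight m₀ ρ n m ≠ 0 →
      ∀ s', σ.act n (fun i => ρ i) s' =
        ∑' m, (τ.weight m₀ ρ n m / ∑' m₁, τ.weight m₀ ρ n m₁) *
          ∑' m', τ.step m (ρ n) (m', s')

/-- `σ` is a finite-memory randomized strategy from `s₀`. -/
def Strategy.IsFiniteMemory {M : MDP S} (σ : M.Strategy) (s₀ : S) : Prop :=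
  ∃ (Mem : Type) (_ : Finite Mem) (τ : M.MemoryRule Mem) (m₀ : Mem), τ.Induces m₀ s₀ σ

/-- `σ` is a `k`-bit Markov strategy from `s₀`: its memory consists of a step counter, which starts
at `0` and is incremented in every step, and of `k` bits of general purpose memory. -/
def Strategy.IsBitMarkov {M : MDP S} (σ : M.Strategy) (s₀ : S) (k : ℕ) : Prop :=
  ∃ (τ : M.MemoryRule (ℕ × (Fin k → Bool))) (b₀ : Fin k → Bool),
    (∀ c b s c' b' s', τ.step (c, b) s ((c', b'), s') ≠ 0 → c' = c + 1) ∧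
      τ.Induces (0, b₀) s₀ σ

end MDP

/-! In a gadget of size `c` a random branch `i ≤ c` earns `i` units, the branches merge, the
controller pays `j` units for a guess `j ≤ c`, and then a failure occurs with probability
`2^(-c(j+1))`. The units grow so fast that a guess `j > i` or a failure leaves a mean payoff of at
most `-1` at the end of the gadget, whatever was gained before.

Branch `i` has probability `2^(ci) / total c`. Hence guessing correctly fails with probability
`(c+1) 2^(-c) / total c` in all, whereas each wrong pair `i ≠ j` carries bad weight at least `1 /
total c`: a guess `j > i` is bad by itself, and for `j < i` the likelihood of the branch outweighs
the small failure probability (`inv_total_le`).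

With `K ≤ c` memory modes, the probabilities of a correct guess after the `c + 1` branches sum to at
most `K` (`MemoryRule.Induces.sum_act_le`). The wrong guesses thus have total mass at least `1`, and
given any past the gadget is bad with probability at least `1 / total c` (`inv_total_mul_le`). Let
each size `c` occur `total c` times. The strategy that recalls the branch then has `∑ (c+1) 2^(-c) <
∞` expected failures, so almost surely finitely many; for bounded memory the lower bounds sum to
`∑_{c ≥ K} 1 = ∞`, and infinitely many gadgets are bad almost surely (`runMeasure_eq_zero`). Finite
memory and `k`-bit Markov strategies are both covered by `BoundedModes`, so both win with
probability `0`. -/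

namespace MDP

/-! ### One-step conditional laws and expectations. -/

variable {S : Type} {M : MDP S}

/-- The law of the next state given the first `n + 1` states of the sequence `x`. -/
noncomputable abbrev Strategy.nextAt (σ : M.Strategy) (n : ℕ) (x : ℕ → S) : PMF S :=
  σ.next n (fun i => x i)

theorem Strategy.nextAt_congr (σ : M.Strategy) {n : ℕ} {x y : ℕ → S} (h : ∀ i ≤ n, x i = y i) :
    σ.nextAt n x = σ.nextAt n y := by
  have : (fun i : Finset.Iic n => x i) = fun i : Finset.Iic n => y i :=
    funext fun i => h i (Finset.mem_Iic.1 i.2)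
  simp only [Strategy.nextAt, this]

theorem Strategy.nextAt_of_mem (σ : M.Strategy) {n : ℕ} {x : ℕ → S} (h : x n ∈ M.controlled) :
    σ.nextAt n x = σ.act n (fun i => x i) := by
  simp [Strategy.nextAt, Strategy.next, h]

theorem Strategy.nextAt_of_notMem (σ : M.Strategy) {n : ℕ} {x : ℕ → S}
    (h : x n ∉ M.controlled) : σ.nextAt n x = M.prob (x n) := by
  simp [Strategy.nextAt, Strategy.next, h]

theorem Strategy.trans_of_nextAt_ne_zero (σ : M.Strategy) {n : ℕ} {x : ℕ → S} {s : S}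
    (h : σ.nextAt n x s ≠ 0) : M.trans (x n) s := by
  by_cases hc : x n ∈ M.controlled
  · rw [σ.nextAt_of_mem hc] at h
    exact σ.act_succ n _ hc s h
  · rw [σ.nextAt_of_notMem hc] at h
    exact M.prob_succ _ hc s h

/-- The conditional expectation of `F` after `n` steps, for `F` that depends on the states up to
time `n + 1`. -/
noncomputable def Strategy.expectNext (σ : M.Strategy) (n : ℕ) (F : (ℕ → S) → ENNReal)
    (x : ℕ → S) : ENNReal :=
  ∑' s, σ.nextAt n x s * F (Function.update x (n + 1) s)

theorem Strategy.dependsOn_expectNext (σ : M.Strategy) {n : ℕ} {F : (ℕ → S) → ENNReal}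
    (hF : DependsOn F (Set.Iic (n + 1))) : DependsOn (σ.expectNext n F) (Set.Iic n) := by
  intro x y h
  refine tsum_congr fun s => ?_
  rw [σ.nextAt_congr h]
  congr 1
  refine hF fun i hi => ?_
  rcases eq_or_ne i (n + 1) with rfl | hne
  · simp
  · simp only [Function.update_of_ne hne]
    exact h i (by simp only [Set.mem_Iic] at hi ⊢; omega)

theorem Strategy.sum_le_expectNext (σ : M.Strategy) {ι : Type} (n : ℕ) (F : (ℕ → S) → ENNReal)
    (x : ℕ → S) (I : Finset ι) {f : ι → S} (hf : Function.Injective f) :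
    ∑ i ∈ I, σ.nextAt n x (f i) * F (Function.update x (n + 1) (f i)) ≤ σ.expectNext n F x :=
  (ENNReal.sum_le_tsum I).trans
    (ENNReal.tsum_comp_le_tsum_of_injective hf
      fun s => σ.nextAt n x s * F (Function.update x (n + 1) s))

/-- Freezing a sequence after time `n` does not change `F`, so `F` factors through finite histories.
For countable `S` these form a countable discrete space, which makes measurability automatic. -/
theorem _root_.DependsOn.eq_comp_extend {β : Type*} {F : (ℕ → S) → β} {n : ℕ}
    (hF : DependsOn F (Set.Iic n)) :
    F = (fun h : (i : Finset.Iic n) → S => F fun i => h ⟨min i n, by simp⟩) ∘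
      Preorder.frestrictLe (π := fun _ => S) n := by
  funext x
  refine hF fun i hi => ?_
  simp [min_eq_left (show i ≤ n from hi)]

/-! ### Strategies with boundedly many memory modes. -/

/-- The restriction on `τ` and `m₀` that both finite memory and boundedly many bits in addition to a
step counter impose: at every time at most `K` memory modes are possible. -/
def MemoryRule.BoundedModes {Mem : Type} (τ : M.MemoryRule Mem) (m₀ : Mem) (K : ℕ) : Prop :=
  ∀ n, ∃ A : Finset Mem, A.card ≤ K ∧ ∀ (ρ : ℕ → S), ∀ m ∉ A, τ.weight m₀ ρ n m = 0

theorem MemoryRule.tsum_weight_succ_of_notMem {Mem : Type} (τ : M.MemoryRule Mem) (m₀ : Mem)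
    {ρ : ℕ → S} {n : ℕ} (h : ρ n ∉ M.controlled) :
    ∑' m, τ.weight m₀ ρ (n + 1) m = (∑' m, τ.weight m₀ ρ n m) * M.prob (ρ n) (ρ (n + 1)) := by
  simp only [MemoryRule.weight]
  rw [ENNReal.tsum_comm, ← ENNReal.tsum_mul_right]
  refine tsum_congr fun m => ?_
  rw [ENNReal.tsum_mul_left, τ.step_random m _ h]

/-- `Induces` constrains only histories of positive weight; this shows that every history with
positive step probabilities is among them. At a controlled state, `Induces` for the shorter prefix
transfers positivity to the memory chain. -/
theorem MemoryRule.Induces.tsum_weight_ne_zero {Mem : Type} {τ : M.MemoryRule Mem} {m₀ : Mem}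
    {s₀ : S} {σ : M.Strategy} (hτ : τ.Induces m₀ s₀ σ) {x : ℕ → S} (h0 : x 0 = s₀) {n : ℕ}
    (h : ∀ i < n, σ.nextAt i x (x (i + 1)) ≠ 0) : ∑' m, τ.weight m₀ x n m ≠ 0 := by
  classical
  induction n with
  | zero => simp [MemoryRule.weight]
  | succ n ih =>
    have ih := ih fun i hi => h i (by omega)
    have hn := h n (by omega)
    by_cases hc : x n ∈ M.controlled
    · rw [σ.nextAt_of_mem hc, hτ x n h0 hc ih] at hn
      intro h1
      apply hn
      rw [ENNReal.tsum_eq_zero] at h1 ⊢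
      intro m
      by_cases hm : τ.weight m₀ x n m = 0
      · simp [hm]
      · have : ∑' m', τ.step m (x n) (m', x (n + 1)) = 0 := by
          rw [ENNReal.tsum_eq_zero]
          intro m'
          have := h1 m'
          simp only [MemoryRule.weight, ENNReal.tsum_eq_zero, mul_eq_zero] at this
          exact (this m).resolve_left hm
        rw [this, mul_zero]
    · rw [σ.nextAt_of_notMem hc] at hn
      rw [τ.tsum_weight_succ_of_notMem m₀ hc]
      exact mul_ne_zero ih hn

/-- With at most `K` memory modes one cannot make more than `K` correct guesses: the
partial runs `x i` end in the same state, and `f i` is the correct choice after `x i`. -/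
theorem MemoryRule.Induces.sum_act_le {Mem ι : Type} {τ : M.MemoryRule Mem} {m₀ : Mem} {K : ℕ}
    (hK : τ.BoundedModes m₀ K) {s₀ : S} {σ : M.Strategy} (hτ : τ.Induces m₀ s₀ σ) (I : Finset ι)
    (x : ι → ℕ → S) (n : ℕ) (s : S) (hs : s ∈ M.controlled) {f : ι → S}
    (hf : Function.Injective f) (h0 : ∀ i ∈ I, x i 0 = s₀) (hn : ∀ i ∈ I, x i n = s)
    (hw : ∀ i ∈ I, ∑' m, τ.weight m₀ (x i) n m ≠ 0) :
    ∑ i ∈ I, σ.nextAt n (x i) (f i) ≤ K := by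
  obtain ⟨A, hAK, hA⟩ := hK n
  have h1 : ∀ i ∈ I, σ.nextAt n (x i) (f i) ≤ ∑ m ∈ A, ∑' m', τ.step m s (m', f i) := by
    intro i hi
    have hc : x i n ∈ M.controlled := by rw [hn i hi]; exact hs
    rw [σ.nextAt_of_mem hc, hτ (x i) n (h0 i hi) hc (hw i hi), tsum_eq_sum (s := A)
      fun m hm => by rw [hA _ m hm]; simp, hn i hi]
    -- The conditional law of the mode depends on `i`. Bounding it by `1` leaves, for each mode, the
    -- masses that a single distribution gives to the distinct states `f i`, at most `1` in total.
    refine Finset.sum_le_sum fun m _ => mul_le_of_le_one_left' ?_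
    exact ENNReal.div_le_of_le_mul (by rw [one_mul]; exact ENNReal.le_tsum m)
  calc ∑ i ∈ I, σ.nextAt n (x i) (f i)
      ≤ ∑ i ∈ I, ∑ m ∈ A, ∑' m', τ.step m s (m', f i) := Finset.sum_le_sum h1
    _ = ∑ m ∈ A, ∑ i ∈ I, ∑' m', τ.step m s (m', f i) := Finset.sum_comm
    _ ≤ ∑ m ∈ A, 1 := by
        refine Finset.sum_le_sum fun m _ => ?_
        calc ∑ i ∈ I, ∑' m', τ.step m s (m', f i)
            ≤ ∑' i, ∑' m', τ.step m s (m', f i) := ENNReal.sum_le_tsum I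
          _ ≤ ∑' t, ∑' m', τ.step m s (m', t) :=
              ENNReal.tsum_comp_le_tsum_of_injective hf fun t => ∑' m', τ.step m s (m', t)
          _ = 1 := by
              rw [ENNReal.tsum_comm, ← ENNReal.tsum_prod, PMF.tsum_coe]
    _ ≤ K := by
        rw [Finset.sum_const, nsmul_one]
        exact_mod_cast hAK

theorem Strategy.IsFiniteMemory.exists_boundedModes {s₀ : S} {σ : M.Strategy}
    (h : σ.IsFiniteMemory s₀) : ∃ (Mem : Type) (τ : M.MemoryRule Mem) (m₀ : Mem) (K : ℕ),
      τ.BoundedModes m₀ K ∧ τ.Induces m₀ s₀ σ := by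
  obtain ⟨Mem, hfin, τ, m₀, hτ⟩ := h
  have := Fintype.ofFinite Mem
  exact ⟨Mem, τ, m₀, _, fun n => ⟨Finset.univ, le_rfl, by simp⟩, hτ⟩

theorem Strategy.IsBitMarkov.exists_boundedModes {s₀ : S} {σ : M.Strategy} {k : ℕ}
    (h : σ.IsBitMarkov s₀ k) : ∃ (Mem : Type) (τ : M.MemoryRule Mem) (m₀ : Mem) (K : ℕ),
      τ.BoundedModes m₀ K ∧ τ.Induces m₀ s₀ σ := by
  classical
  obtain ⟨τ, b₀, hstep, hτ⟩ := h
  -- The step counter equals the time, so only the bits distinguish the possible modes.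
  have key : ∀ (ρ : ℕ → S) n c b, c ≠ n → τ.weight (0, b₀) ρ n (c, b) = 0 := by
    intro ρ n
    induction n with
    | zero =>
      intro c b hc
      simp [MemoryRule.weight, hc]
    | succ n ih =>
      intro c b hc
      simp only [MemoryRule.weight, ENNReal.tsum_eq_zero]
      rintro ⟨c', b'⟩
      by_contra hne
      obtain ⟨h1, h2⟩ := mul_ne_zero_iff.1 hne
      have h3 := hstep _ _ _ _ _ _ h2
      have h4 : c' = n := by
        by_contra h5
        exact h1 (ih c' b' h5)
      omega
  refine ⟨_, τ, _, _, fun n =>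
    ⟨Finset.univ.image fun b : Fin k → Bool => (n, b), Finset.card_image_le, ?_⟩, hτ⟩
  rintro ρ ⟨c, b⟩ hm
  refine key ρ n c b fun hc => hm ?_
  simp [hc]

/-! ### Integration against the run measure. -/

section Measure

variable [Countable S] [MeasurableSpace S] [DiscreteMeasurableSpace S]

instance (s₀ : S) (σ : M.Strategy) : IsProbabilityMeasure (M.runMeasure s₀ σ) := by
  unfold runMeasure
  infer_instance

theorem _root_.DependsOn.measurable_of_Iic {β : Type*} [MeasurableSpace β] {F : (ℕ → S) → β}
    {n : ℕ} (hF : DependsOn F (Set.Iic n)) : Measurable F := by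
  rw [hF.eq_comp_extend]
  exact Measurable.of_discrete.comp (Preorder.measurable_frestrictLe n)

theorem lintegral_ite_of_dependsOn (μ : Measure (ℕ → S)) {P : (ℕ → S) → Prop}
    [DecidablePred P] {n : ℕ} (hP : DependsOn P (Set.Iic n)) :
    ∫⁻ x, (if P x then 1 else 0) ∂μ = μ {x | P x} := by
  have h : MeasurableSet {x | P x} := measurableSet_setOfPred.2 hP.measurable_of_Iic
  rw [← lintegral_indicator_one h]
  exact lintegral_congr fun x => by simp [Set.indicator_apply]

/-- The tower property: iterating it integrates out the last steps of a gadget one by one. -/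
theorem lintegral_expectNext (s₀ : S) (σ : M.Strategy) {n : ℕ} {F : (ℕ → S) → ENNReal}
    (hF : DependsOn F (Set.Iic (n + 1))) :
    ∫⁻ x, F x ∂(M.runMeasure s₀ σ) = ∫⁻ x, σ.expectNext n F x ∂(M.runMeasure s₀ σ) := by
  classical
  let ext : ((i : Finset.Iic n) → S) → S → ℕ → S := fun h s =>
    Function.update (fun i => h ⟨min i n, by simp⟩) (n + 1) s
  let F' : ((i : Finset.Iic n) → S) × S → ENNReal := fun p => F (ext p.1 p.2)
  have hext : ∀ (x : ℕ → S) s, F (ext (Preorder.frestrictLe (π := fun _ => S) n x) s) =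
      F (Function.update x (n + 1) s) := by
    intro x s
    refine hF fun i hi => ?_
    rcases eq_or_ne i (n + 1) with rfl | hne
    · simp [ext]
    · have : i ≤ n := by simp only [Set.mem_Iic] at hi; omega
      simp [ext, Function.update_of_ne hne, min_eq_left this]
  have h1 : F = fun x => F' (Preorder.frestrictLe (π := fun _ => S) n x, x (n + 1)) := by
    funext x
    simp only [F', hext, Function.update_eq_self]
  have hm : Measurable fun h : (i : Finset.Iic n) → S =>
      ∫⁻ s, F' (h, s) ∂(σ.kernel n h) := Measurable.of_discrete
  calc ∫⁻ x, F x ∂(M.runMeasure s₀ σ)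
      = ∫⁻ p, F' p ∂(Measure.map (fun x : ℕ → S =>
          (Preorder.frestrictLe (π := fun _ => S) n x, x (n + 1))) (M.runMeasure s₀ σ)) := by
        rw [lintegral_map Measurable.of_discrete (by fun_prop)]
        exact congrArg (fun f => lintegral _ f) h1
    _ = ∫⁻ h, ∫⁻ s, F' (h, s) ∂(σ.kernel n h)
          ∂(Measure.map (Preorder.frestrictLe (π := fun _ => S) n) (M.runMeasure s₀ σ)) := by
        rw [runMeasure, ← Kernel.partialTraj_compProd_eq_map_traj (Nat.zero_le n),
          Measure.lintegral_compProd Measurable.of_discrete, Kernel.traj_map_frestrictLe_apply]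
    _ = _ := by
        rw [lintegral_map hm (Preorder.measurable_frestrictLe n)]
        refine lintegral_congr fun x => ?_
        rw [lintegral_countable']
        refine tsum_congr fun s => ?_
        rw [mul_comm]
        congr 1
        · exact PMF.toMeasure_apply_singleton _ _ (measurableSet_singleton _)
        · exact hext x s

theorem ae_initial (s₀ : S) (σ : M.Strategy) : ∀ᵐ x ∂(M.runMeasure s₀ σ), x 0 = s₀ := by
  have h := M.runMeasure_cylinder s₀ σ (fun _ => s₀) rfl 0
  simp only [Nat.le_zero, forall_eq, Finset.range_zero, Finset.prod_empty] at h
  exact mem_ae_iff_prob_eq_one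
    (measurableSet_eq_fun (measurable_pi_apply 0) measurable_const) |>.2 h

theorem ae_nextAt_ne_zero (s₀ : S) (σ : M.Strategy) :
    ∀ᵐ x ∂(M.runMeasure s₀ σ), ∀ n, σ.nextAt n x (x (n + 1)) ≠ 0 := by
  classical
  rw [ae_all_iff]
  intro n
  let F : (ℕ → S) → ENNReal := fun x => if σ.nextAt n x (x (n + 1)) = 0 then 1 else 0
  have hF : DependsOn F (Set.Iic (n + 1)) := by
    intro x y h
    have h1 : x (n + 1) = y (n + 1) := h _ (by simp)
    simp only [F]
    rw [σ.nextAt_congr fun i hi => h i (by simp; omega), h1]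
  have h0 : ∫⁻ x, F x ∂(M.runMeasure s₀ σ) = 0 := by
    rw [lintegral_expectNext s₀ σ hF]
    simp only [lintegral_eq_zero_iff' (σ.dependsOn_expectNext hF).measurable_of_Iic.aemeasurable]
    refine Eventually.of_forall fun x => ENNReal.tsum_eq_zero.2 fun s => ?_
    have : σ.nextAt n (Function.update x (n + 1) s) = σ.nextAt n x :=
      σ.nextAt_congr fun i hi => Function.update_of_ne (by omega) _ _
    simp only [F, this, Function.update_self, mul_ite, mul_one, mul_zero]
    split_ifs with h <;> simp [h]
  rw [lintegral_eq_zero_iff' hF.measurable_of_Iic.aemeasurable] at h0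
  filter_upwards [h0] with x hx h
  simp [F, h] at hx

end Measure

end MDP

/-! ### Laws, widths and reward scales of the gadgets. -/

namespace GuessingMDP

/-- The normalization of the geometric weights `(2 ^ b) ^ i` for `i ≤ b`. -/
def total (b : ℕ) : ℕ := ∑ i ∈ Finset.range (b + 1), (2 ^ b) ^ i

theorem total_pos (b : ℕ) : 0 < total b :=
  Finset.sum_pos (fun i _ => by positivity) ⟨0, by simp⟩

/-- The law of the branch that has to be guessed. -/
noncomputable def branchLaw (b : ℕ) : PMF ℕ :=
  PMF.ofFinset (fun i => if i ∈ Finset.range (b + 1) then (((2 ^ b) ^ i : ℕ) : ENNReal) / total b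
    else 0) (Finset.range (b + 1)) (by
      rw [Finset.sum_ite_mem, Finset.inter_self]
      simp only [div_eq_mul_inv]
      rw [← Finset.sum_mul, ← Nat.cast_sum]
      exact ENNReal.mul_inv_cancel (by exact_mod_cast (total_pos b).ne') (by simp))
    (by intro a ha; simp only [if_neg ha])

theorem branchLaw_apply {b i : ℕ} (h : i ≤ b) :
    branchLaw b i = (((2 ^ b) ^ i : ℕ) : ENNReal) / total b := by
  rw [branchLaw, PMF.ofFinset_apply, if_pos (Finset.mem_range.2 (by omega))]

theorem branchLaw_apply_of_lt {b i : ℕ} (h : b < i) : branchLaw b i = 0 := by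
  rw [branchLaw, PMF.ofFinset_apply, if_neg (by simp; omega)]

/-- The probability to fail after the guess `j`. -/
noncomputable def failProb (b j : ℕ) : ENNReal := (((2 ^ b) ^ (j + 1) : ℕ) : ENNReal)⁻¹

theorem failProb_le_one (b j : ℕ) : failProb b j ≤ 1 :=
  ENNReal.inv_le_one.2 (by exact_mod_cast Nat.one_le_pow _ _ (by positivity))

/-- The law of the failure flag after the guess `j`. -/
noncomputable def failLaw (b j : ℕ) : PMF ℕ :=
  PMF.ofFinset (fun g => if g = 0 then 1 - failProb b j else if g = 1 then failProb b j else 0)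
    (Finset.range 2) (by
      simp only [Finset.sum_range_succ, Finset.range_zero, Finset.sum_empty, zero_add, if_true,
        one_ne_zero, if_false]
      exact tsub_add_cancel_of_le (failProb_le_one b j))
    (by
      intro a ha
      rw [Finset.mem_range] at ha
      rw [if_neg (by omega), if_neg (by omega)])

theorem failLaw_one (b j : ℕ) : failLaw b j 1 = failProb b j := by
  simp [failLaw]

theorem failLaw_apply_of_le {b j g : ℕ} (h : 2 ≤ g) : failLaw b j g = 0 := by
  rw [failLaw, PMF.ofFinset_apply, if_neg (by omega), if_neg (by omega)]

variable (b : ℕ → ℕ)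

/-- The number of states at time `n`. -/
def width (n : ℕ) : ℕ :=
  -- The residues of the time modulo 4 stand for: `0` the failure flag of the preceding gadget, `1`
  -- the branch, `2` the merged state, `3` the guess.
  if n % 4 = 0 then 2 else if n % 4 = 2 then 1 else b (n / 4) + 1

theorem width_pos (n : ℕ) : 0 < width b n := by
  unfold width
  split_ifs <;> omega

/-- The law of the label of the successor of the random state `s`. -/
noncomputable def labelLaw (s : ℕ × ℕ) : PMF ℕ :=
  if s.1 % 4 = 0 then branchLaw (b (s.1 / 4))
  else if s.1 % 4 = 3 then failLaw (b (s.1 / 4)) s.2 else PMF.pure 0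

theorem lt_width_of_labelLaw_ne_zero {s : ℕ × ℕ} (hs : s.1 % 4 ≠ 2) {a : ℕ}
    (h : labelLaw b s a ≠ 0) : a < width b (s.1 + 1) := by
  unfold labelLaw at h
  unfold width
  split_ifs at h with h0 h3
  · have : ¬ b (s.1 / 4) < a := fun hlt => h (branchLaw_apply_of_lt hlt)
    rw [if_neg (by omega), if_neg (by omega), show (s.1 + 1) / 4 = s.1 / 4 by omega]
    omega
  · have : ¬ 2 ≤ a := fun hle => h (failLaw_apply_of_le hle)
    rw [if_pos (by omega)]
    omega
  · rw [if_neg (by omega), if_pos (by omega)]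
    have : a = 0 := by simpa using h
    omega

/-- The size of the rewards of the gadget `t`. -/
noncomputable def scale : ℕ → ℝ
  | 0 => 5
  -- In units of `scale b t`: `b t` cover the largest gain in gadget `t`, one covers the payoff
  -- before it, and one is left to keep the payoff negative after a failure.
  | t + 1 => (b t + 2) * scale t

theorem five_le_scale (t : ℕ) : 5 ≤ scale b t := by
  induction t with
  | zero => simp [scale]
  | succ t ih =>
    have : (0 : ℝ) ≤ b t := Nat.cast_nonneg _
    simp only [scale]
    nlinarith

end GuessingMDP

open GuessingMDP

/-- A sequence of gadgets. States are pairs of a time and a label. The gadget `t` starts at time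
`4 * t` with a random branch `i ≤ b t` and a gain proportional to `i`. The branches are joined,
and then a controller chooses `j ≤ b t` at a loss proportional to `j`. Finally there is
a random failure that is less likely for large `j`, indicated by the label `1` at time
`4 * t + 4`. -/
noncomputable def guessingMDP (b : ℕ → ℕ) : MDP (ℕ × ℕ) where
  controlled := {s | s.1 % 4 = 2}
  trans s s' := s'.1 = s.1 + 1 ∧ s'.2 < width b s'.1
  exists_succ s := ⟨(s.1 + 1, 0), rfl, width_pos b _⟩
  prob s := (labelLaw b s).map fun a => (s.1 + 1, a)
  prob_succ s hs s' h := by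
    obtain ⟨a, ha, rfl⟩ := (PMF.mem_support_map_iff _ _ _).1 ((PMF.mem_support_iff _ _).2 h)
    exact ⟨rfl, lt_width_of_labelLaw_ne_zero b hs ((PMF.mem_support_iff _ _).1 ha)⟩
  reward s s' :=
    if s.1 % 4 = 0 then s'.2 * scale b (s.1 / 4)
    else if s.1 % 4 = 2 then -(s'.2 * scale b (s.1 / 4))
    else if s.1 % 4 = 3 then -(s'.2 * scale b (s.1 / 4 + 1)) else 0

namespace GuessingMDP

/-! ### Structure of the graph and payoffs along runs. -/

open MDP

variable {b : ℕ → ℕ}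

theorem fst_of_isPath {s t : ℕ × ℕ} {l : ℕ} {path : ℕ → ℕ × ℕ}
    (h : (guessingMDP b).IsPath s t l path) {i : ℕ} (hi : i ≤ l) : (path i).1 = s.1 + i := by
  induction i with
  | zero => rw [h.1]; rfl
  | succ i ih => rw [(h.2.2 i (by omega)).1, ih (by omega)]; rfl

theorem stepCounterImplicit : (guessingMDP b).StepCounterImplicit (0, 0) := by
  refine fun s => ⟨s.1, fun l path h => ?_⟩
  have := fst_of_isPath h le_rfl
  rw [h.2.1] at this
  simpa using this.symm

theorem acyclic : (guessingMDP b).Acyclic := by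
  have key : ∀ s t, Relation.TransGen (guessingMDP b).trans s t → s.1 < t.1 := by
    intro s t h
    induction h with
    | single h => rw [h.1]; omega
    | tail _ h ih => rw [h.1]; omega
  exact fun s h => (key s s h).false

theorem finitelyBranching : (guessingMDP b).FinitelyBranching := by
  intro s
  refine ((Set.finite_singleton (s.1 + 1)).prod (Set.finite_Iio (width b (s.1 + 1)))).subset ?_
  rintro ⟨n, a⟩ ⟨h1, h2⟩
  simp only at h1 h2
  subst h1
  exact ⟨rfl, h2⟩

/-- `x` is a run from the initial state. -/
def IsRun (b : ℕ → ℕ) (x : ℕ → ℕ × ℕ) : Prop :=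
  x 0 = (0, 0) ∧ ∀ n, (guessingMDP b).trans (x n) (x (n + 1))

namespace IsRun

variable {x : ℕ → ℕ × ℕ} (hx : IsRun b x)
include hx

theorem fst_eq (n : ℕ) : (x n).1 = n := by
  induction n with
  | zero => rw [hx.1]
  | succ n ih => rw [(hx.2 n).1, ih]

theorem snd_lt (n : ℕ) : (x (n + 1)).2 < width b (n + 1) := by
  have := (hx.2 n).2
  rwa [hx.fst_eq] at this

theorem branch_le (t : ℕ) : (x (4 * t + 1)).2 ≤ b t := by
  have := hx.snd_lt (4 * t)
  rw [width, if_neg (by omega), if_neg (by omega), show (4 * t + 1) / 4 = t by omega] at this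
  omega

theorem flag_lt (t : ℕ) : (x (4 * t + 4)).2 < 2 := by
  have := hx.snd_lt (4 * t + 3)
  rwa [width, if_pos (by omega)] at this

theorem reward_zero (t : ℕ) : (guessingMDP b).reward (x (4 * t)) (x (4 * t + 1)) =
    (x (4 * t + 1)).2 * scale b t := by
  simp only [guessingMDP, hx.fst_eq]
  rw [if_pos (by omega), show 4 * t / 4 = t by omega]

theorem reward_one (t : ℕ) :
    (guessingMDP b).reward (x (4 * t + 1)) (x (4 * t + 2)) = 0 := by
  simp only [guessingMDP, hx.fst_eq]
  rw [if_neg (by omega), if_neg (by omega), if_neg (by omega)]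

theorem reward_two (t : ℕ) : (guessingMDP b).reward (x (4 * t + 2)) (x (4 * t + 3)) =
    -((x (4 * t + 3)).2 * scale b t) := by
  simp only [guessingMDP, hx.fst_eq]
  rw [if_neg (by omega), if_pos (by omega), show (4 * t + 2) / 4 = t by omega]

theorem reward_three (t : ℕ) : (guessingMDP b).reward (x (4 * t + 3)) (x (4 * t + 4)) =
    -((x (4 * t + 4)).2 * scale b (t + 1)) := by
  simp only [guessingMDP, hx.fst_eq]
  rw [if_neg (by omega), if_neg (by omega), if_pos (by omega),
    show (4 * t + 3) / 4 = t by omega]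

end IsRun

/-- The sum of the first `n` rewards. -/
noncomputable def payoff (b : ℕ → ℕ) (x : ℕ → ℕ × ℕ) (n : ℕ) : ℝ :=
  ∑ j ∈ Finset.range n, (guessingMDP b).reward (x j) (x (j + 1))

/-- In the gadget `t` the guess is too large, or there is a failure. -/
def Bad (t : ℕ) (x : ℕ → ℕ × ℕ) : Prop :=
  (x (4 * t + 1)).2 < (x (4 * t + 3)).2 ∨ (x (4 * t + 4)).2 = 1

namespace IsRun

variable {x : ℕ → ℕ × ℕ} (hx : IsRun b x)
include hx

theorem payoff_gadget (t : ℕ) :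
    payoff b x (4 * t + 1) = payoff b x (4 * t) + (x (4 * t + 1)).2 * scale b t ∧
    payoff b x (4 * t + 2) = payoff b x (4 * t) + (x (4 * t + 1)).2 * scale b t ∧
    payoff b x (4 * t + 3) = payoff b x (4 * t) +
      ((x (4 * t + 1)).2 - (x (4 * t + 3)).2) * scale b t ∧
    payoff b x (4 * (t + 1)) = payoff b x (4 * t) +
      ((x (4 * t + 1)).2 - (x (4 * t + 3)).2) * scale b t -
      (x (4 * t + 4)).2 * scale b (t + 1) := by
  have h1 : payoff b x (4 * t + 1) = payoff b x (4 * t) + _ := Finset.sum_range_succ _ _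
  have h2 : payoff b x (4 * t + 2) = payoff b x (4 * t + 1) + _ := Finset.sum_range_succ _ _
  have h3 : payoff b x (4 * t + 3) = payoff b x (4 * t + 2) + _ := Finset.sum_range_succ _ _
  have h4 : payoff b x (4 * (t + 1)) = payoff b x (4 * t + 3) +
      (guessingMDP b).reward (x (4 * t + 3)) (x (4 * t + 4)) := Finset.sum_range_succ _ _
  rw [hx.reward_zero] at h1
  rw [hx.reward_one] at h2
  rw [hx.reward_two] at h3
  rw [hx.reward_three] at h4
  refine ⟨h1, ?_, ?_, ?_⟩ <;> linarith

/-- All earlier gains together stay below one unit of the current gadget, so a single unit lost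
makes the payoff negative. The margin of `5` per gadget exceeds its `4` steps, as a mean payoff of
at most `-1` requires. -/
theorem payoff_add_le_scale (t : ℕ) : payoff b x (4 * t) + 5 * (t + 1) ≤ scale b t := by
  induction t with
  | zero => simp [payoff, scale]
  | succ t ih =>
    have h := (hx.payoff_gadget t).2.2.2
    have h5 := five_le_scale b t
    have h6 := five_le_scale b (t + 1)
    have hb : ((x (4 * t + 1)).2 : ℝ) ≤ b t := by exact_mod_cast hx.branch_le t
    have hj : (0 : ℝ) ≤ (x (4 * t + 3)).2 := Nat.cast_nonneg _
    have hg : (0 : ℝ) ≤ (x (4 * t + 4)).2 * scale b (t + 1) :=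
      mul_nonneg (Nat.cast_nonneg _) (by linarith)
    have hm : ((x (4 * t + 1)).2 - (x (4 * t + 3)).2 : ℝ) * scale b t ≤ b t * scale b t :=
      mul_le_mul_of_nonneg_right (by linarith) (by linarith)
    simp only [scale] at *
    push_cast
    linarith

theorem payoff_le_of_bad {t : ℕ} (h : Bad t x) :
    payoff b x (4 * (t + 1)) ≤ -(4 * (t + 1) : ℕ) := by
  have h4 := (hx.payoff_gadget t).2.2.2
  have h0 := hx.payoff_add_le_scale t
  have h5 := five_le_scale b t
  have h6 := five_le_scale b (t + 1)
  have hb : ((x (4 * t + 1)).2 : ℝ) ≤ b t := by exact_mod_cast hx.branch_le t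
  have ht : (0 : ℝ) ≤ t := Nat.cast_nonneg _
  have hj : (0 : ℝ) ≤ (x (4 * t + 3)).2 := Nat.cast_nonneg _
  push_cast
  rcases h with h | h
  · have hg : (0 : ℝ) ≤ (x (4 * t + 4)).2 * scale b (t + 1) :=
      mul_nonneg (Nat.cast_nonneg _) (by linarith)
    have h' : ((x (4 * t + 1)).2 : ℝ) + 1 ≤ (x (4 * t + 3)).2 := by exact_mod_cast h
    have hm : ((x (4 * t + 1)).2 - (x (4 * t + 3)).2 : ℝ) * scale b t ≤ (-1) * scale b t :=
      mul_le_mul_of_nonneg_right (by linarith) (by linarith)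
    linarith
  · have hm : ((x (4 * t + 1)).2 - (x (4 * t + 3)).2 : ℝ) * scale b t ≤ b t * scale b t :=
      mul_le_mul_of_nonneg_right (by linarith) (by linarith)
    rw [h] at h4
    simp only [scale] at *
    push_cast at h4
    linarith

theorem notMem_of_frequently_bad (h : ∃ᶠ t in atTop, Bad t x) :
    x ∉ (guessingMDP b).meanPayoffLiminfNonneg := by
  intro hmem
  have h1 : ∃ᶠ n : ℕ in atTop, (((1 / (n : ℝ)) * payoff b x n : ℝ) : EReal) ≤ ((-1 : ℝ) : EReal) := by
    have ht : Tendsto (fun t : ℕ => 4 * (t + 1)) atTop atTop :=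
      tendsto_atTop_mono (fun t => by show t ≤ _; omega) tendsto_id
    refine ht.frequently (h.mono fun t hbad => ?_)
    rw [EReal.coe_le_coe_iff]
    have hp : (0 : ℝ) < (4 * (t + 1) : ℕ) := by positivity
    rw [one_div, inv_mul_le_iff₀ hp]
    linarith [hx.payoff_le_of_bad hbad]
  have h2 := liminf_le_of_frequently_le h1
  have h3 : (0 : EReal) ≤ ((-1 : ℝ) : EReal) := le_trans hmem h2
  rw [← EReal.coe_zero, EReal.coe_le_coe_iff] at h3
  linarith

/-- After the last failure every gadget returns the payoff to the value it started from. In between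
the payoff is never lower, because the gain precedes the loss; dividing by `n` sends this constant
lower bound to `0`. -/
theorem mem_of_eventually (h : ∀ᶠ t in atTop, (x (4 * t + 4)).2 ≠ 1)
    (hguess : ∀ t, (x (4 * t + 3)).2 = (x (4 * t + 1)).2) :
    x ∈ (guessingMDP b).meanPayoffLiminfNonneg := by
  obtain ⟨T, hT⟩ := eventually_atTop.1 h
  have hconst : ∀ t, T ≤ t → payoff b x (4 * t) = payoff b x (4 * T) := by
    intro t ht
    induction t, ht using Nat.le_induction with
    | base => rfl
    | succ t ht ih =>
      have h0 : (x (4 * t + 4)).2 = 0 := by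
        have := hT t ht
        have := hx.flag_lt t
        omega
      rw [(hx.payoff_gadget t).2.2.2, hguess, h0, ih]
      simp
  have hlow : ∀ n, 4 * T ≤ n → payoff b x (4 * T) ≤ payoff b x n := by
    intro n hn
    obtain ⟨t, r, hr, rfl⟩ : ∃ t r, r < 4 ∧ n = 4 * t + r :=
      ⟨n / 4, n % 4, Nat.mod_lt _ (by norm_num), (Nat.div_add_mod n 4).symm⟩
    rw [← hconst t (by omega)]
    obtain ⟨h1, h2, h3, -⟩ := hx.payoff_gadget t
    have hm : (0 : ℝ) ≤ (x (4 * t + 1)).2 * scale b t :=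
      mul_nonneg (Nat.cast_nonneg _) (by linarith [five_le_scale b t])
    interval_cases r
    · exact le_rfl
    · linarith
    · linarith
    · rw [h3, hguess]; simp
  have hlim : Tendsto (fun n : ℕ => (((1 / (n : ℝ)) * payoff b x (4 * T) : ℝ) : EReal)) atTop
      (nhds ((0 : ℝ) : EReal)) := by
    rw [EReal.tendsto_coe]
    simpa using (tendsto_one_div_atTop_nhds_zero_nat (𝕜 := ℝ)).mul_const (payoff b x (4 * T))
  show (0 : EReal) ≤ _
  rw [← EReal.coe_zero, ← hlim.liminf_eq]
  refine liminf_le_liminf ?_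
  filter_upwards [eventually_ge_atTop (4 * T)] with n hn
  rw [EReal.coe_le_coe_iff]
  exact mul_le_mul_of_nonneg_left (hlow n hn) (by positivity)

end IsRun

end GuessingMDP

/-! ### Winning probabilities. -/

namespace GuessingMDP

open MDP

variable {b : ℕ → ℕ}

theorem ae_isRun (σ : (guessingMDP b).Strategy) :
    ∀ᵐ x ∂((guessingMDP b).runMeasure (0, 0) σ), IsRun b x := by
  filter_upwards [ae_initial (0, 0) σ, ae_nextAt_ne_zero (0, 0) σ] with x h0 h
  exact ⟨h0, fun n => σ.trans_of_nextAt_ne_zero (h n)⟩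

theorem prob_apply (s : ℕ × ℕ) (a : ℕ) :
    (guessingMDP b).prob s (s.1 + 1, a) = labelLaw b s a := by
  have : ∀ a', ((s.1 + 1, a) = (s.1 + 1, a')) ↔ a' = a := by
    intro a'
    simp [eq_comm]
  simp only [guessingMDP, PMF.map_apply, this]
  exact tsum_ite_eq a _

theorem tsum_prob_mul (s : ℕ × ℕ) (g : ℕ × ℕ → ENNReal) :
    ∑' s', (guessingMDP b).prob s s' * g s' = ∑' a, labelLaw b s a * g (s.1 + 1, a) := by
  simp only [guessingMDP, PMF.map_apply, ← ENNReal.tsum_mul_right, ite_mul, zero_mul]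
  rw [ENNReal.tsum_comm]
  exact tsum_congr fun a => tsum_ite_eq _ _

theorem labelLaw_branch {s : ℕ × ℕ} {t : ℕ} (h : s.1 = 4 * t) :
    labelLaw b s = branchLaw (b t) := by
  rw [labelLaw, if_pos (by omega), show s.1 / 4 = t by omega]

theorem labelLaw_join {s : ℕ × ℕ} {t : ℕ} (h : s.1 = 4 * t + 1) :
    labelLaw b s = PMF.pure 0 := by
  rw [labelLaw, if_neg (by omega), if_neg (by omega)]

theorem labelLaw_fail {s : ℕ × ℕ} {t : ℕ} (h : s.1 = 4 * t + 3) :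
    labelLaw b s = failLaw (b t) s.2 := by
  rw [labelLaw, if_neg (by omega), if_pos (by omega), show s.1 / 4 = t by omega]

theorem nextAt_random (σ : (guessingMDP b).Strategy) {x : ℕ → ℕ × ℕ} {n : ℕ}
    (h : (x n).1 % 4 ≠ 2) : σ.nextAt n x = (guessingMDP b).prob (x n) :=
  σ.nextAt_of_notMem h

theorem nextAt_random_apply (σ : (guessingMDP b).Strategy) {x : ℕ → ℕ × ℕ} {n : ℕ}
    (hn : (x n).1 = n) (h : n % 4 ≠ 2) (a : ℕ) :
    σ.nextAt n x (n + 1, a) = labelLaw b (x n) a := by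
  rw [nextAt_random σ (by rw [hn]; exact h), ← prob_apply, hn]

theorem expectNext_random (σ : (guessingMDP b).Strategy) {x : ℕ → ℕ × ℕ} {n : ℕ}
    (hn : (x n).1 = n) (h : n % 4 ≠ 2) (F : (ℕ → ℕ × ℕ) → ENNReal) :
    σ.expectNext n F x = ∑' a, labelLaw b (x n) a * F (Function.update x (n + 1) (n + 1, a)) := by
  rw [Strategy.expectNext, nextAt_random σ (by rw [hn]; exact h), tsum_prob_mul, hn]

/-! ### The winning strategy -/

/-- The strategy that remembers the branch. -/
noncomputable def recallBranch (b : ℕ → ℕ) : (guessingMDP b).Strategy where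
  act n h :=
    let T := (h ⟨n, Finset.mem_Iic.2 le_rfl⟩).1
    -- On runs, controlled states occur at times `4 * t + 2`, so `n - 1` is the time of the branch.
    -- The default `0` below matters only for histories that are not runs, where the label may be
    -- too large to be a legal guess.
    let a := (h ⟨n - 1, Finset.mem_Iic.2 (Nat.sub_le n 1)⟩).2
    PMF.pure (T + 1, if a ≤ b (T / 4) then a else 0)
  act_succ n h hc s' hs' := by
    simp only [ne_eq, PMF.pure_apply, ite_eq_right_iff, one_ne_zero, imp_false, not_not] at hs'
    subst hs'
    have hc : (h ⟨n, Finset.mem_Iic.2 le_rfl⟩).1 % 4 = 2 := hc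
    have hw : width b ((h ⟨n, Finset.mem_Iic.2 le_rfl⟩).1 + 1) =
        b ((h ⟨n, Finset.mem_Iic.2 le_rfl⟩).1 / 4) + 1 := by
      rw [width, if_neg (by omega), if_neg (by omega)]
      congr 2
      omega
    refine ⟨rfl, lt_of_lt_of_eq ?_ hw.symm⟩
    simp only
    split_ifs <;> omega

theorem ae_recall : ∀ᵐ x ∂((guessingMDP b).runMeasure (0, 0) (recallBranch b)),
    ∀ t, (x (4 * t + 3)).2 = (x (4 * t + 1)).2 := by
  filter_upwards [ae_isRun (recallBranch b), ae_nextAt_ne_zero (0, 0) (recallBranch b)] with x hx h t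
  have h2 := h (4 * t + 2)
  have hc : x (4 * t + 2) ∈ (guessingMDP b).controlled := by
    show (x (4 * t + 2)).1 % 4 = 2
    rw [hx.fst_eq]
    omega
  rw [Strategy.nextAt_of_mem _ hc] at h2
  simp only [recallBranch, ne_eq, PMF.pure_apply, ite_eq_right_iff, one_ne_zero, imp_false,
    not_not] at h2
  rw [show 4 * t + 3 = 4 * t + 2 + 1 from rfl, h2]
  simp only [hx.fst_eq, show (4 * t + 2) / 4 = t by omega]
  exact if_pos (hx.branch_le t)

/-- The geometric weights cancel, so that every branch contributes equally. -/
theorem tsum_branchLaw_mul_failProb (c : ℕ) :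
    ∑' i, branchLaw c i * failProb c i = (c + 1) * ((total c : ENNReal)⁻¹ * (2 ^ c)⁻¹) := by
  rw [tsum_eq_sum (s := Finset.range (c + 1)) fun i hi => by
    rw [branchLaw_apply_of_lt (by simpa using hi), zero_mul]]
  have : ∀ i ∈ Finset.range (c + 1),
      branchLaw c i * failProb c i = (total c : ENNReal)⁻¹ * (2 ^ c)⁻¹ := by
    intro i hi
    rw [Finset.mem_range] at hi
    rw [branchLaw_apply (by omega), failProb, pow_succ]
    push_cast
    have h0 : ((2 : ENNReal) ^ c) ^ i ≠ 0 := by positivity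
    have h1 : ((2 : ENNReal) ^ c) ^ i ≠ ⊤ := by finiteness
    rw [ENNReal.mul_inv (Or.inl h0) (Or.inl h1), div_eq_mul_inv]
    calc _ = ((2 : ENNReal) ^ c) ^ i * (((2 : ENNReal) ^ c) ^ i)⁻¹ *
          ((total c : ENNReal)⁻¹ * (2 ^ c)⁻¹) := by ring
      _ = _ := by rw [ENNReal.mul_inv_cancel h0 h1, one_mul]
  rw [Finset.sum_congr rfl this, Finset.sum_const, Finset.card_range, nsmul_eq_mul]
  push_cast
  rfl

theorem runMeasure_recall_flag (t : ℕ) :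
    (guessingMDP b).runMeasure (0, 0) (recallBranch b) {x | (x (4 * t + 4)).2 = 1} =
      (b t + 1) * ((total (b t) : ENNReal)⁻¹ * (2 ^ b t)⁻¹) := by
  have hP : DependsOn (fun x : ℕ → ℕ × ℕ => (x (4 * t + 4)).2 = 1)
      (Set.Iic (4 * t + 3 + 1)) := by
    intro x y h
    simp only [h (4 * t + 4) (by simp)]
  have hF : DependsOn (fun x : ℕ → ℕ × ℕ => if (x (4 * t + 4)).2 = 1 then (1 : ENNReal) else 0)
      (Set.Iic (4 * t + 3 + 1)) := by
    intro x y h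
    simp only [h (4 * t + 4) (by simp)]
  have hF2 : DependsOn (fun x : ℕ → ℕ × ℕ => failProb (b t) (x (4 * t + 1)).2)
      (Set.Iic (4 * t + 1)) := by
    intro x y h
    simp only [h (4 * t + 1) (by simp)]
  rw [← lintegral_ite_of_dependsOn _ hP, lintegral_expectNext _ _ hF]
  -- Almost surely the guess equals the branch, so the failure probability is a function of the
  -- label at time `4 * t + 1`, and one further averaging over `branchLaw` computes it.
  trans ∫⁻ x, failProb (b t) (x (4 * t + 1)).2 ∂((guessingMDP b).runMeasure (0, 0) (recallBranch b))
  · refine lintegral_congr_ae ?_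
    filter_upwards [ae_isRun (recallBranch b), ae_recall] with x hx hr
    rw [expectNext_random _ (hx.fst_eq _) (by omega), labelLaw_fail (hx.fst_eq _),
      tsum_eq_single 1, failLaw_one, hr]
    · simp
    · intro a ha
      simp [ha]
  · rw [lintegral_expectNext _ _ hF2, ← tsum_branchLaw_mul_failProb]
    trans ∫⁻ x, ∑' i, branchLaw (b t) i * failProb (b t) i
        ∂((guessingMDP b).runMeasure (0, 0) (recallBranch b))
    · refine lintegral_congr_ae ?_
      filter_upwards [ae_isRun (recallBranch b)] with x hx
      rw [expectNext_random _ (hx.fst_eq _) (by omega), labelLaw_branch (hx.fst_eq _)]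
      simp
    · simp

theorem measurableSet_meanPayoffLiminfNonneg :
    MeasurableSet (guessingMDP b).meanPayoffLiminfNonneg := by
  have hr : Measurable fun p : (ℕ × ℕ) × (ℕ × ℕ) => (guessingMDP b).reward p.1 p.2 :=
    Measurable.of_discrete
  refine measurableSet_le measurable_const (Measurable.liminf fun n => ?_)
  refine Measurable.coe_real_ereal (Measurable.const_mul
    (Finset.measurable_fun_sum _ fun j _ => ?_) _)
  exact hr.comp ((measurable_pi_apply (X := fun _ => ℕ × ℕ) j).prodMk
    (measurable_pi_apply (X := fun _ => ℕ × ℕ) (j + 1)))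

theorem runMeasure_recall_eq_one
    (hb : ∑' t, ((b t : ENNReal) + 1) * ((total (b t) : ENNReal)⁻¹ * (2 ^ b t)⁻¹) ≠ ⊤) :
    (guessingMDP b).runMeasure (0, 0) (recallBranch b) (guessingMDP b).meanPayoffLiminfNonneg = 1 := by
  rw [← mem_ae_iff_prob_eq_one measurableSet_meanPayoffLiminfNonneg]
  have h := ae_eventually_notMem (μ := (guessingMDP b).runMeasure (0, 0) (recallBranch b))
    (s := fun t => {x | (x (4 * t + 4)).2 = 1}) (by simpa only [runMeasure_recall_flag] using hb)
  filter_upwards [h, ae_isRun (recallBranch b), ae_recall] with x h1 hx hr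
  exact hx.mem_of_eventually h1 hr

/-! ### Strategies with boundedly many memory modes -/

/-- The conditional probability that a gadget with parameter `c` is bad, given the branch `i` and
the guess `j`. -/
noncomputable def badProb (c i j : ℕ) : ENNReal := if i < j then 1 else failProb c j

/-- If `j < i` then `j + 1 ≤ i`, and the weight `(2 ^ c) ^ i` absorbs `failProb c j`. If `i < j` the
gadget is surely bad, and the weight is at least `1`. -/
theorem inv_total_le {c i j : ℕ} (hi : i ≤ c) (hij : i ≠ j) :
    (total c : ENNReal)⁻¹ ≤ branchLaw c i * badProb c i j := by
  rw [branchLaw_apply hi, badProb, div_eq_mul_inv]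
  split_ifs with h
  · rw [mul_one]
    refine le_mul_of_one_le_left' ?_
    exact_mod_cast Nat.one_le_pow _ _ (by positivity)
  · rw [mul_right_comm, failProb]
    refine le_mul_of_one_le_left' ?_
    have h0 : (((2 ^ c) ^ (j + 1) : ℕ) : ENNReal) ≠ 0 := by
      exact_mod_cast (by positivity : (2 ^ c) ^ (j + 1) ≠ 0)
    rw [← ENNReal.mul_inv_cancel h0 (by finiteness)]
    gcongr
    · exact Nat.one_le_two_pow
    · omega

theorem dependsOn_bad (t : ℕ) : DependsOn (Bad t) (Set.Iic (4 * t + 4)) := by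
  intro x y h
  simp only [Bad, h (4 * t + 1) (by simp), h (4 * t + 3) (by simp), h (4 * t + 4) (by simp)]

open Classical in
/-- Guessing with boundedly many memory modes: in a large gadget, the conditional
probability of a bad event is bounded from below. -/
theorem inv_total_mul_le {σ : (guessingMDP b).Strategy} {Mem : Type}
    {τ : (guessingMDP b).MemoryRule Mem} {m₀ : Mem} {K : ℕ} (hK : τ.BoundedModes m₀ K)
    (hτ : τ.Induces m₀ (0, 0) σ) {t : ℕ} (ht : K ≤ b t) {E : (ℕ → ℕ × ℕ) → Prop}
    (hE : DependsOn E (Set.Iic (4 * t))) :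
    (total (b t) : ENNReal)⁻¹ * (guessingMDP b).runMeasure (0, 0) σ {x | E x} ≤
      (guessingMDP b).runMeasure (0, 0) σ {x | E x ∧ Bad t x} := by
  set μ := (guessingMDP b).runMeasure (0, 0) σ
  set N := b t
  let e : (ℕ → ℕ × ℕ) → ENNReal := fun x => if E x then 1 else 0
  have he : ∀ x y : ℕ → ℕ × ℕ, (∀ i ≤ 4 * t, x i = y i) → e x = e y := by
    intro x y h
    have : E x = E y := hE fun i hi => h i hi
    simp only [e, this]
  have hP : DependsOn (fun x => E x ∧ Bad t x) (Set.Iic (4 * t + 3 + 1)) := by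
    intro x y h
    have h1 : E x = E y := hE fun i hi => h i (by simp at hi ⊢; omega)
    have h2 : Bad t x = Bad t y := dependsOn_bad t h
    simp only [h1, h2]
  -- The indices count how much of the gadget is still visible: `F₃` sees the flag, `F₂` bounds its
  -- conditional expectation after the guess from below, and `F₁` does so after the merge.
  let F₃ : (ℕ → ℕ × ℕ) → ENNReal := fun x => if E x ∧ Bad t x then 1 else 0
  have hF₃ : DependsOn F₃ (Set.Iic (4 * t + 3 + 1)) := by
    intro x y h
    have := hP h
    simp only at this
    simp only [F₃, this]
  let F₂ : (ℕ → ℕ × ℕ) → ENNReal := fun x =>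
    e x * badProb N (x (4 * t + 1)).2 (x (4 * t + 3)).2
  have hF₂ : DependsOn F₂ (Set.Iic (4 * t + 2 + 1)) := by
    intro x y h
    simp only [F₂, he x y fun i hi => h i (by simp; omega), h (4 * t + 1) (by simp),
      h (4 * t + 3) (by simp)]
  let F₁ : (ℕ → ℕ × ℕ) → ENNReal := fun x =>
    e x * ∑ j ∈ Finset.range (N + 1), σ.nextAt (4 * t + 2) x (4 * t + 3, j) *
      badProb N (x (4 * t + 1)).2 j
  have hF₁ : DependsOn F₁ (Set.Iic (4 * t + 1 + 1)) := by
    intro x y h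
    simp only [F₁, he x y fun i hi => h i (by simp; omega), h (4 * t + 1) (by simp),
      σ.nextAt_congr (n := 4 * t + 2) fun i hi => h i (by simpa using hi)]
  have step₃ : ∫⁻ x, F₂ x ∂μ ≤ μ {x | E x ∧ Bad t x} := by
    rw [← lintegral_ite_of_dependsOn _ hP]
    refine le_trans ?_ (lintegral_expectNext (0, 0) σ hF₃).ge
    refine lintegral_mono_ae ?_
    filter_upwards [ae_isRun σ] with x hx
    have hu : ∀ s, E (Function.update x (4 * t + 4) s) = E x := fun s =>
      hE fun i hi => Function.update_of_ne (by simp at hi; omega) _ _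
    by_cases hex : E x
    swap
    · simp [F₂, e, hex]
    simp only [F₂, e, hex, if_true, one_mul, badProb]
    split_ifs with hlt
    · have : ∀ s, F₃ (Function.update x (4 * t + 4) s) = 1 := by
        intro s
        simp only [F₃, hu, hex, Bad]
        rw [if_pos]
        refine ⟨trivial, Or.inl ?_⟩
        rwa [Function.update_of_ne (by omega), Function.update_of_ne (by omega)]
      simp only [Strategy.expectNext, this, mul_one, PMF.tsum_coe, le_refl]
    · rw [expectNext_random _ (hx.fst_eq _) (by omega), labelLaw_fail (hx.fst_eq _)]
      refine le_trans (le_of_eq ?_) (ENNReal.le_tsum 1)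
      rw [failLaw_one]
      simp only [F₃, hu, hex, Bad]
      rw [if_pos ⟨trivial, Or.inr (by simp)⟩, mul_one]
  have step₂ : ∫⁻ x, F₁ x ∂μ ≤ ∫⁻ x, F₂ x ∂μ := by
    rw [lintegral_expectNext _ _ hF₂]
    refine lintegral_mono fun x => ?_
    refine le_trans (le_of_eq ?_) (σ.sum_le_expectNext (4 * t + 2) F₂ x (Finset.range (N + 1))
      (f := fun j => (4 * t + 3, j)) fun i j h => by simpa using h)
    simp only [F₁, F₂]
    rw [Finset.mul_sum]
    refine Finset.sum_congr rfl fun j _ => ?_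
    rw [he (Function.update x (4 * t + 2 + 1) (4 * t + 3, j)) x fun i hi =>
        Function.update_of_ne (by omega) _ _,
      Function.update_of_ne (by omega), Function.update_self]
    ring
  refine le_trans ?_ (step₂.trans step₃)
  rw [lintegral_expectNext _ _ hF₁, lintegral_expectNext _ _ (σ.dependsOn_expectNext hF₁),
    ← lintegral_ite_of_dependsOn _ hE, ← lintegral_const_mul _ (Measurable.ite
      (measurableSet_setOfPred.2 hE.measurable_of_Iic) measurable_const measurable_const)]
  refine lintegral_mono_ae ?_
  filter_upwards [ae_isRun σ, ae_nextAt_ne_zero (0, 0) σ] with x hx hx'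
  let y : ℕ → ℕ → ℕ × ℕ := fun i => Function.update x (4 * t + 1) (4 * t + 1, i)
  -- `z i` is the alternative history that agrees with `x` up to time `4 * t`, then takes branch `i`
  -- and merges.
  let z : ℕ → ℕ → ℕ × ℕ := fun i => Function.update (y i) (4 * t + 2) (4 * t + 2, 0)
  have hz0 : ∀ i k, k ≤ 4 * t → z i k = x k := fun i k hk => by
    simp only [z, y]
    rw [Function.update_of_ne (by omega), Function.update_of_ne (by omega)]
  have hz1 : ∀ i, z i (4 * t + 1) = (4 * t + 1, i) := fun i => by
    simp only [z, y]
    rw [Function.update_of_ne (by omega), Function.update_self]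
  have hz2 : ∀ i, z i (4 * t + 2) = (4 * t + 2, 0) := fun i => Function.update_self _ _ _
  have hy1 : ∀ i, y i (4 * t + 1) = (4 * t + 1, i) := fun i => Function.update_self _ _ _
  let A : ℕ → ℕ → ENNReal := fun i j => σ.nextAt (4 * t + 2) (z i) (4 * t + 3, j)
  have hjoin : ∀ i, F₁ (z i) ≤ σ.expectNext (4 * t + 1) F₁ (y i) := by
    intro i
    rw [expectNext_random _ (by rw [hy1]) (by omega), labelLaw_join (t := t) (by rw [hy1])]
    refine le_trans (le_of_eq ?_) (ENNReal.le_tsum 0)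
    simp [z]
  have hbranch : ∑ i ∈ Finset.range (N + 1), branchLaw N i * F₁ (z i) ≤
      σ.expectNext (4 * t) (σ.expectNext (4 * t + 1) F₁) x := by
    rw [expectNext_random _ (hx.fst_eq _) (by omega), labelLaw_branch (hx.fst_eq _)]
    refine le_trans (Finset.sum_le_sum fun i _ => ?_) (ENNReal.sum_le_tsum (Finset.range (N + 1)))
    gcongr
    exact hjoin i
  refine le_trans ?_ hbranch
  have hsum : ∀ i, ∑ j ∈ Finset.range (N + 1), A i j = 1 := by
    intro i
    rw [← (σ.nextAt (4 * t + 2) (z i)).tsum_coe,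
      tsum_eq_sum (s := (Finset.range (N + 1)).image fun j => (4 * t + 3, j)),
      Finset.sum_image fun _ _ _ _ h => by simpa using h]
    rintro ⟨n, j⟩ hs
    by_contra hne
    obtain ⟨h1, h2⟩ := σ.trans_of_nextAt_ne_zero hne
    rw [hz2] at h1
    simp only at h1
    subst h1
    simp only [width] at h2
    rw [if_neg (by omega), if_neg (by omega), show (4 * t + 2 + 1) / 4 = t by omega] at h2
    exact hs (Finset.mem_image.2 ⟨j, Finset.mem_range.2 h2, rfl⟩)
  -- All `z i` end in the same merged state, so only the memory can tell the branches apart.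
  have hdiag : ∑ i ∈ Finset.range (N + 1), A i i ≤ K := by
    refine hτ.sum_act_le hK (Finset.range (N + 1)) z (4 * t + 2) (4 * t + 2, 0) ?_
      (f := fun j => (4 * t + 3, j)) (fun i j h => by simpa using h) ?_ (fun i _ => hz2 i) ?_
    · show (4 * t + 2) % 4 = 2
      omega
    · intro i _
      rw [hz0 i 0 (by omega), hx.1]
    · intro i hi
      rw [Finset.mem_range] at hi
      refine hτ.tsum_weight_ne_zero (σ := σ) (by rw [hz0 i 0 (by omega), hx.1]) fun k hk => ?_
      rcases lt_or_ge k (4 * t) with hk' | hk'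
      · rw [σ.nextAt_congr (y := x) fun l hl => hz0 i l (by omega), hz0 i _ (by omega)]
        exact hx' k
      · obtain rfl | rfl : k = 4 * t ∨ k = 4 * t + 1 := by omega
        · rw [hz1, nextAt_random_apply _ (by rw [hz0 i _ le_rfl, hx.fst_eq]) (by omega),
            labelLaw_branch (t := t) (by rw [hz0 i _ le_rfl, hx.fst_eq]),
            branchLaw_apply (by omega)]
          refine ENNReal.div_ne_zero.2 ⟨?_, by simp⟩
          exact_mod_cast (by positivity : (2 ^ b t) ^ i ≠ 0)
        · rw [hz2, nextAt_random_apply _ (by rw [hz1]) (by omega),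
            labelLaw_join (t := t) (by rw [hz1])]
          simp
  -- The `N + 1` rows of `A` sum to `1` each, and the diagonal takes at most `K ≤ N`.
  have hoff : 1 ≤ ∑ i ∈ Finset.range (N + 1), ∑ j ∈ (Finset.range (N + 1)).erase i, A i j := by
    have h1 : ∑ i ∈ Finset.range (N + 1), A i i +
        ∑ i ∈ Finset.range (N + 1), ∑ j ∈ (Finset.range (N + 1)).erase i, A i j = N + 1 := by
      rw [← Finset.sum_add_distrib, Finset.sum_congr rfl fun i hi =>
        (Finset.add_sum_erase _ (A i) hi).trans (hsum i)]
      simp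
    by_contra hlt
    rw [not_le] at hlt
    have hKN : (K : ENNReal) ≤ N := by exact_mod_cast ht
    have : ∑ i ∈ Finset.range (N + 1), A i i +
        ∑ i ∈ Finset.range (N + 1), ∑ j ∈ (Finset.range (N + 1)).erase i, A i j < N + 1 :=
      ENNReal.add_lt_add_of_le_of_lt (ne_top_of_le_ne_top (by simp) hdiag) (hdiag.trans hKN) hlt
    exact this.ne h1
  by_cases hex : E x
  swap
  · simp [hex]
  have hez : ∀ i, e (z i) = 1 := fun i => by
    rw [he (z i) x (hz0 i)]
    simp [e, hex]
  rw [if_pos hex, mul_one]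
  calc (total (b t) : ENNReal)⁻¹ = (total N : ENNReal)⁻¹ * 1 := (mul_one _).symm
    _ ≤ (total N : ENNReal)⁻¹ *
        ∑ i ∈ Finset.range (N + 1), ∑ j ∈ (Finset.range (N + 1)).erase i, A i j := by gcongr
    _ ≤ ∑ i ∈ Finset.range (N + 1), branchLaw N i * F₁ (z i) := by
      rw [Finset.mul_sum]
      refine Finset.sum_le_sum fun i hi => ?_
      simp only [F₁, hez, one_mul, hz1]
      rw [Finset.mul_sum, Finset.mul_sum]
      refine le_trans (Finset.sum_le_sum fun j hj => ?_)
        (Finset.sum_le_sum_of_subset (Finset.erase_subset i _))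
      rw [mul_left_comm, mul_comm]
      gcongr
      exact inv_total_le (by simpa [Nat.lt_succ_iff] using hi) (Finset.ne_of_mem_erase hj).symm

theorem runMeasure_eq_zero
    (hb : ∀ K : ℕ, ∑' t, (if K ≤ b t then (total (b t) : ENNReal)⁻¹ else 0) = ⊤)
    {σ : (guessingMDP b).Strategy} {Mem : Type}
    {τ : (guessingMDP b).MemoryRule Mem} {m₀ : Mem} {K : ℕ} (hK : τ.BoundedModes m₀ K)
    (hτ : τ.Induces m₀ (0, 0) σ) :
    (guessingMDP b).runMeasure (0, 0) σ (guessingMDP b).meanPayoffLiminfNonneg = 0 := by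
  set μ := (guessingMDP b).runMeasure (0, 0) σ
  have key : ∀ T, μ {x | ∀ t, T ≤ t → ¬ Bad t x} = 0 := by
    intro T
    let E : ℕ → (ℕ → ℕ × ℕ) → Prop := fun t x => ∀ s, T ≤ s → s < t → ¬ Bad s x
    have hE : ∀ t, DependsOn (E t) (Set.Iic (4 * t)) := by
      intro t x y h
      refine propext (forall₃_congr fun s _ hs => not_congr (iff_of_eq (dependsOn_bad s ?_)))
      exact fun i hi => h i (by simp at hi ⊢; omega)
    -- `G t` says that gadget `t + T` is the first bad one from `T` on. These events are disjoint,
    -- so their probabilities sum to at most `1`; this takes the place of independence in the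
    -- converse Borel–Cantelli argument.
    let G : ℕ → Set (ℕ → ℕ × ℕ) := fun t => {x | E (t + T) x ∧ Bad (t + T) x}
    have hG : ∀ t, MeasurableSet (G t) := fun t =>
      (measurableSet_setOfPred.2 (hE _).measurable_of_Iic).inter
        (measurableSet_setOfPred.2 (dependsOn_bad _).measurable_of_Iic)
    have hdisj : Pairwise (Function.onFun (AEDisjoint μ) G) := by
      have hlt : ∀ s t, s < t → Disjoint (G s) (G t) := fun s t hst =>
        Set.disjoint_left.2 fun x hs ht => ht.1 (s + T) (by omega) (by omega) hs.2
      intro s t hst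
      rcases lt_or_gt_of_ne hst with h | h
      · exact (hlt s t h).aedisjoint
      · exact (hlt t s h).symm.aedisjoint
    have hsum : ∑' t, μ (G t) ≤ 1 := by
      have := tsum_measure_le_measure_univ (μ := μ) (fun t => (hG t).nullMeasurableSet) hdisj
      rwa [measure_univ] at this
    by_contra hne
    let c : ℕ → ENNReal := fun t => if K ≤ b t then (total (b t) : ENNReal)⁻¹ else 0
    have hc : ∑' t, c (t + T) = ⊤ := by
      have h1 : ∑ t ∈ Finset.range T, c t + ∑' t, c (t + T) = ∑' t, c t :=
        Summable.sum_add_tsum_nat_add' ENNReal.summable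
      have h2 : ∑' t, c t = ⊤ := hb K
      rw [h2, ENNReal.add_eq_top] at h1
      refine h1.resolve_left ((ENNReal.sum_lt_top.2 fun t _ => ?_).ne)
      simp only [c]
      split_ifs
      · exact ENNReal.inv_lt_top.2 (by exact_mod_cast total_pos _)
      · simp
    -- Having no bad gadget from `T` on implies `E (t + T)`. The never-bad probability is therefore
    -- a common factor in all lower bounds, and must vanish because the `c (t + T)` have infinite
    -- sum.
    have hle : ∀ t, c (t + T) * μ {x | ∀ t, T ≤ t → ¬ Bad t x} ≤ μ (G t) := by
      intro t
      simp only [c]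
      split_ifs with h
      · have hsub : {x | ∀ t, T ≤ t → ¬ Bad t x} ⊆ {x | E (t + T) x} :=
          fun x (hx : ∀ t, T ≤ t → ¬ Bad t x) s hs _ => hx s hs
        exact (mul_le_mul_right (measure_mono hsub) _).trans
          (inv_total_mul_le hK hτ h (hE (t + T)))
      · simp
    have := (ENNReal.tsum_le_tsum hle).trans hsum
    rw [ENNReal.tsum_mul_right, hc, ENNReal.top_mul hne] at this
    simp at this
  rw [measure_eq_zero_iff_ae_notMem]
  have hall : ∀ᵐ x ∂μ, ∀ T, ¬ ∀ t, T ≤ t → ¬ Bad t x :=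
    ae_all_iff.2 fun T => measure_eq_zero_iff_ae_notMem.1 (key T)
  filter_upwards [hall, ae_isRun σ] with x h hx
  refine hx.notMem_of_frequently_bad (frequently_atTop.2 fun T => ?_)
  have := h T
  push Not at this
  exact this

/-! ### The sizes of the gadgets -/

instance : Infinite (Σ c, Fin (total c)) :=
  Infinite.of_injective (fun c => ⟨c, ⟨0, total_pos c⟩⟩) fun _ _ h => congrArg Sigma.fst h

/-- An enumeration in which every `c` occurs `total c` times. -/
noncomputable def size (t : ℕ) : ℕ :=
  ((nonempty_equiv_of_countable (α := ℕ) (β := Σ c, Fin (total c))).some t).1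

/-- Sums over gadgets become sums over sizes; the multiplicity `total c` cancels the normalization
of `branchLaw c`. -/
theorem tsum_size (f : ℕ → ENNReal) : ∑' t, f (size t) = ∑' c, total c * f c := by
  rw [← ((nonempty_equiv_of_countable (α := ℕ) (β := Σ c, Fin (total c))).some.symm.tsum_eq
    fun t => f (size t))]
  simp only [size, Equiv.apply_symm_apply]
  rw [ENNReal.tsum_sigma fun c (_ : Fin (total c)) => f c]
  simp

theorem total_mul_inv_cancel (c : ℕ) : (total c : ENNReal) * (total c : ENNReal)⁻¹ = 1 :=
  ENNReal.mul_inv_cancel (by exact_mod_cast (total_pos c).ne') (by simp)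

theorem tsum_size_ge (K : ℕ) :
    ∑' t, (if K ≤ size t then (total (size t) : ENNReal)⁻¹ else 0) = ⊤ := by
  rw [tsum_size fun c => if K ≤ c then (total c : ENNReal)⁻¹ else 0]
  rw [eq_top_iff, ← ENNReal.tsum_const_eq_top_of_ne_zero (α := ℕ) one_ne_zero]
  refine le_trans (ENNReal.tsum_le_tsum fun c => ?_) (ENNReal.tsum_comp_le_tsum_of_injective
    (add_left_injective K)
    fun c => (total c : ENNReal) * if K ≤ c then (total c : ENNReal)⁻¹ else 0)
  rw [if_pos (by omega), total_mul_inv_cancel]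

theorem tsum_size_ne_top :
    ∑' t, ((size t : ENNReal) + 1) * ((total (size t) : ENNReal)⁻¹ * (2 ^ size t)⁻¹) ≠ ⊤ := by
  rw [tsum_size fun c => ((c : ENNReal) + 1) * ((total c : ENNReal)⁻¹ * (2 ^ c)⁻¹)]
  have h1 : Summable fun c : ℕ => ((c : ℝ) + 1) * (1 / 2) ^ c := by
    have h := summable_pow_mul_geometric_of_norm_lt_one (R := ℝ) (r := 1 / 2) 1 (by norm_num)
    have h' := summable_geometric_of_lt_one (r := (1 / 2 : ℝ)) (by norm_num) (by norm_num)
    refine (h.add h').congr fun c => ?_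
    ring
  convert h1.tsum_ofReal_ne_top using 3 with c
  rw [mul_left_comm, ← mul_assoc (total c : ENNReal), total_mul_inv_cancel, one_mul,
    ENNReal.ofReal_mul (by positivity), ENNReal.ofReal_add (by positivity) (by positivity),
    ENNReal.ofReal_pow (by positivity), ENNReal.ofReal_natCast, ENNReal.ofReal_one, one_div,
    ENNReal.ofReal_inv_of_pos (by positivity), ENNReal.inv_pow]
  simp

end GuessingMDP

/-! ### The main theorem. -/

open GuessingMDP in
theorem mainTheorem6 :
    ∃ (S : Type) (_ : Countable S) (_ : MeasurableSpace S) (_ : DiscreteMeasurableSpace S)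
      (M : MDP S) (s₀ : S),
      M.Acyclic ∧ M.FinitelyBranching ∧ M.StepCounterImplicit s₀ ∧
      (∃ σ : M.Strategy, M.runMeasure s₀ σ M.meanPayoffLiminfNonneg = 1) ∧
      (∀ σ : M.Strategy, σ.IsFiniteMemory s₀ →
        M.runMeasure s₀ σ M.meanPayoffLiminfNonneg = 0) ∧
      (∀ (k : ℕ) (σ : M.Strategy), σ.IsBitMarkov s₀ k →
        M.runMeasure s₀ σ M.meanPayoffLiminfNonneg ≠ 1) := by
  refine ⟨ℕ × ℕ, inferInstance, inferInstance, inferInstance, guessingMDP size, (0, 0), acyclic,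
    finitelyBranching, stepCounterImplicit, ⟨recallBranch size, ?_⟩, fun σ hσ => ?_, fun k σ hσ => ?_⟩
  · exact runMeasure_recall_eq_one tsum_size_ne_top
  · obtain ⟨Mem, τ, m₀, K, hK, hτ⟩ := hσ.exists_boundedModes
    exact runMeasure_eq_zero tsum_size_ge hK hτ
  · obtain ⟨Mem, τ, m₀, K, hK, hτ⟩ := hσ.exists_boundedModes
    rw [runMeasure_eq_zero tsum_size_ge hK hτ]
    exact zero_ne_one
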